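/- Let $\Sigma=\{\ell,h\}$ and let $\Delta_\Sigma$ be the set of probability distributions on $\Sigma$. A scoring rule $PS:\Sigma\times\Delta_\Sigma\to\mathbb R$ is strictly proper if $\mathbb E_{s\sim p}[PS(s,p)]\ge\mathbb E_{s\sim p}[PS(s,p')]$ for all $p,p'\in\Delta_\Sigma$, with equality only if $p=p'$. Agents $1,\dots,n$ receive private signals $\Psi_1,\dots,\Psi_n\in\Sigma$ drawn from a common prior $\mathcal Q$ on $\Sigma^n$ that is invariant under permutations of the agents and under which each agent receives each signal with positive probability. For $i\ne j$ write $\Pr(s\mid s')=\Pr(\Psi_j=s\mid\Psi_i=s')$ and $q_{s'}=\Pr(\cdot\mid s')\in\Delta_\Sigma$. Assume $\Pr(h\mid h)>\Pr(h\mid\ell)$, $\Pr(h\mid\ell)>0$ and $\Pr(\ell\mid h)>0$. In the peer prediction mechanism each agent $i$ reports some $a_i\in\Sigma$ and receives the utility $\frac1{n-1}\sum_{j\ne i}PS(a_j,q_{a_i})$. A (mixed) strategy $\sigma_i$ of agent $i$ maps the signal of $i$ to a distribution on reports, and $u_i(\sigma\mid s)$ is the interim expected utility of $i$ under the profile $\sigma=(\sigma_1,\dots,\sigma_n)$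 conditioned on $\Psi_i=s$. Truthful reporting is the profile in which every agent always reports the own signal. For an integer $k\ge1$, a profile $\sigma$ is a Bayesian $k$-strong equilibrium if there are no set $D$ of at most $k$ agents and profile $\sigma'\ne\sigma$ such that $\sigma'_i=\sigma_i$ for all $i\notin D$; $u_i(\sigma'\mid s)\ge u_i(\sigma\mid s)$ for all $i\in D$ and $s\in\Sigma$; and $u_i(\sigma'\mid s)>u_i(\sigma\mid s)$ for some $i\in D$ and $s\in\Sigma$. Set $$k_B^h=\begin{cases}\left\lceil\dfrac{(n-1)\,\mathbb E_{s\sim q_\ell}[PS(s,q_\ell)-PS(s,q_h)]}{\Pr(\ell\mid\ell)\,(PS(h,q_h)-PS(\ell,q_h))}\right\rceil&\text{if }PS(h,q_h)>PS(\ell,q_h),\\ n&\text{otherwise,}\end{cases}$$ $$k_B^\ell=\begin{cases}\left\lceil\dfrac{(n-1)\,\mathbb E_{s\sim q_h}[PS(s,q_h)-PS(s,q_\ell)]}{\Pr(h\mid h)\,(PS(\ell,q_\ell)-PS(h,q_\ell))}\right\rceil&\text{if }PS(\ell,q_\ell)>PS(h,q_\ell),\\ n&\text{otherwise,}\end{cases}$$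 and $k_B=\min(k_B^h,k_B^\ell,n)$. Theorem. Let $PS$ be a strictly proper scoring rule and let $q_\ell,q_h\in\Delta_\Sigma$ satisfy the assumptions above. There is an $n_0$, depending only on $PS$ and on $(q_\ell,q_h)$, such that for every $n\ge n_0$ and every common prior of $n$ agents as above with posteriors $q_\ell,q_h$, truthful reporting in the peer prediction mechanism is a Bayesian $k$-strong equilibrium for every $1\le k\le k_B$, and is not a Bayesian $k$-strong equilibrium for any $k$ with $k_B<k\le n$. -/

import Mathlib

open Finset

noncomputable section

/-- Probability distributions on a finite set. -/
abbrev FinDist (Ω : Type) [Fintype Ω] : Type := stdSimplex ℝ Ω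

/-- The probability of an event under a distribution on a finite set. -/
def FinDist.prob {Ω : Type} [Fintype Ω] (μ : FinDist Ω) (E : Ω → Prop) [DecidablePred E] : ℝ :=
  ∑ ω with E ω, μ ω

/-! ### Scoring rules -/

/-- The expected score of the forecast `p'` when the outcome is drawn from `p`. -/
def expectedScore {Ω : Type} [Fintype Ω] (PS : Ω → FinDist Ω → ℝ) (p p' : FinDist Ω) : ℝ :=
  ∑ s, p s * PS s p'

/-- A scoring rule is strictly proper if it is proper (no forecast beats the true distribution)
and only the true distribution attains the optimal expected score. -/
def IsStrictlyProper {Ω : Type} [Fintype Ω] (PS : Ω → FinDist Ω → ℝ) : Prop :=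
  ∀ p p' : FinDist Ω, expectedScore PS p p' ≤ expectedScore PS p p ∧
    (expectedScore PS p p = expectedScore PS p p' → p = p')

/-! ### Bayesian games with `n` agents, finite type sets `T i` and finite action sets `A i` -/

/-- A Bayesian game: utility functions depending on the agent's own type and on all actions, and a
common prior on type vectors in which every type of every agent has positive probability. -/
structure BayesianGame (n : ℕ) (T A : Fin n → Type)
    [∀ i, Fintype (T i)] [∀ i, DecidableEq (T i)] where
  utility : ∀ i, T i → (∀ j, A j) → ℝ
  prior : FinDist (∀ i, T i)
  marginal_pos : ∀ (i : Fin n) (t : T i), 0 < prior.prob (fun S => S i = t)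

/-- Profiles of mixed strategies. -/
abbrev StrategyProfile (n : ℕ) (T A : Fin n → Type) [∀ i, Fintype (A i)] : Type :=
  ∀ i, T i → FinDist (A i)

namespace BayesianGame

variable {n : ℕ} {T A : Fin n → Type} [∀ i, Fintype (T i)] [∀ i, DecidableEq (T i)]
  [∀ i, Fintype (A i)]

/-- The interim expected utility of agent `i`, conditioned on having type `t`: the type vector is
drawn from the prior conditioned on the type of `i` being `t`, and then the agents draw
their actions independently from their strategies. -/
def interimUtility (G : BayesianGame n T A) (σ : StrategyProfile n T A) (i : Fin n) (t : T i) : ℝ :=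
  ∑ S with S i = t, (G.prior S / G.prior.prob (fun S' => S' i = t)) *
    ∑ a : ∀ j, A j, (∏ j, σ j (S j) (a j)) * G.utility i t a

/-- Bayesian `k`-strong equilibrium. -/
def IsBayesianStrongEquilibrium (G : BayesianGame n T A) (k : ℕ) (σ : StrategyProfile n T A) :
    Prop :=
  ¬ ∃ (D : Finset (Fin n)) (σ' : StrategyProfile n T A), D.card ≤ k ∧ σ' ≠ σ ∧
    (∀ i, i ∉ D → σ' i = σ i) ∧
    (∀ i ∈ D, ∀ t : T i, G.interimUtility σ i t ≤ G.interimUtility σ' i t) ∧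
    (∃ i ∈ D, ∃ t : T i, G.interimUtility σ i t < G.interimUtility σ' i t)

end BayesianGame

/-! ### The peer prediction mechanism -/

/-- The two signals `ℓ` and `h`. -/
inductive Signal : Type
  | l
  | h
  deriving DecidableEq

instance : Fintype Signal where
  elems := {Signal.l, Signal.h}
  complete s := by cases s <;> simp

/-- A common prior on the signals of `n` agents which is symmetric under permutations of the agents
and gives positive probability to each signal of each agent. -/
structure SymmetricPrior (n : ℕ) where
  dist : FinDist (Fin n → Signal)
  marginal_pos : ∀ (i : Fin n) (s : Signal), 0 < dist.prob (fun S => S i = s)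
  symmetric : ∀ (π : Equiv.Perm (Fin n)) (S : Fin n → Signal), dist (fun i => S (π i)) = dist S

/-- `q s'` is the posterior distribution on the signal of another agent held by an agent with
signal `s'`. -/
def SymmetricPrior.HasPosterior {n : ℕ} (Q : SymmetricPrior n) (q : Signal → FinDist Signal) : Prop :=
  ∀ i j : Fin n, i ≠ j → ∀ s s' : Signal,
    q s' s = Q.dist.prob (fun S => S i = s' ∧ S j = s) / Q.dist.prob (fun S => S i = s')

/-- The Bayesian game given by the peer prediction mechanism: the utility of agent `i` is the
average, over all other agents `j`, of the score of the forecast `q (a i)` at the report `a j`. -/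
def peerPrediction {n : ℕ} (Q : SymmetricPrior n) (q : Signal → FinDist Signal)
    (PS : Signal → FinDist Signal → ℝ) :
    BayesianGame n (fun _ => Signal) (fun _ => Signal) where
  utility i _ a := 1 / ((n : ℝ) - 1) * ∑ j ∈ univ.erase i, PS (a j) (q (a i))
  prior := Q.dist
  marginal_pos := Q.marginal_pos

/-- The profile in which every agent reports the own signal with probability one. -/
def truthful (n : ℕ) : StrategyProfile n (fun _ => Signal) (fun _ => Signal) :=
  fun _ s => stdSimplex.vertex s

open Classical in
/-- The threshold from all deviators reporting `h`. -/
def thresholdH (q : Signal → FinDist Signal) (PS : Signal → FinDist Signal → ℝ) (n : ℕ) : ℕ :=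
  if PS .h (q .h) > PS .l (q .h) then
    ⌈((n : ℝ) - 1) * (∑ s, q .l s * (PS s (q .l) - PS s (q .h))) /
      (q .l .l * (PS .h (q .h) - PS .l (q .h)))⌉₊
  else n

open Classical in
/-- The threshold from all deviators reporting `ℓ`. -/
def thresholdL (q : Signal → FinDist Signal) (PS : Signal → FinDist Signal → ℝ) (n : ℕ) : ℕ :=
  if PS .l (q .l) > PS .h (q .l) then
    ⌈((n : ℝ) - 1) * (∑ s, q .h s * (PS s (q .h) - PS s (q .l))) /
      (q .h .h * (PS .l (q .l) - PS .h (q .l)))⌉₊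
  else n

/-- The threshold `k_B`. -/
def threshold (q : Signal → FinDist Signal) (PS : Signal → FinDist Signal → ℝ) (n : ℕ) : ℕ :=
  min (min (thresholdH q PS n) (thresholdL q PS n)) n

end

/-!
Truthful reporting can be upset only by coalitions above the threshold, for the following reason.

The utility of an agent is an average over pairs, so the interim utilities depend on the prior only
through the posteriors `q` (`interimUtility_peerPrediction`). With `x j` and `y j` the probabilities
that agent `j` misreports the signals `ℓ` and `h`, the gain of agent `i` over truthful reporting is
bilinear in the own misreport and in the shift of the reports of the others (`reportShift`); see
`mul_interimUtility_l` and `mul_interimUtility_h`. Strict properness makes the two losses from a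
wrong forecast positive, and makes the slope of the score in the reported signal strictly larger for
the forecast `q h` than for `q ℓ` (`scoreSlope_sub_mul`). So the slope of `q h` is positive or that
of `q ℓ` is negative, and exchanging the signals reduces the second case to the first.

Suppose that the slope of `q h` is positive, and that no member of a coalition below both thresholds
loses. An agent with signal `h` would lose if the others shifted their reports towards `ℓ`: the
truthful report suffers from the shift, and the misreport does not recover its loss, by the second
threshold. So the others shift towards `h` from the viewpoint of signal `h`, and a fortiori from the
viewpoint of signal `ℓ`. Consider the member who misreports `ℓ` most often, with probability `m`.
The gain from the shift is at most proportional to `m` times the size of the coalition minus one,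
and the misreport costs `m` times the loss, which is more by the first threshold unless `m = 0`.
Hence nobody misreports `ℓ`, and then nobody misreports `h` (`misreports_eq_zero_of_slope_pos`).

Conversely, above a threshold all members of a coalition report the signal that belongs to the
threshold: a member with the other signal does not lose, by the choice of the threshold, and a
member with that signal gains strictly. No estimate needs `n` to be larger than two.
-/

/-! ### Interim utilities -/

theorem sum_signal {M : Type*} [AddCommMonoid M] (f : Signal → M) :
    ∑ s, f s = f .l + f .h := by
  have : (univ : Finset Signal) = {Signal.l, Signal.h} := rfl
  rw [this, sum_pair (by decide)]

theorem FinDist.apply_l_add_apply_h (p : FinDist Signal) : p .l + p .h = 1 := by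
  rw [← sum_signal (fun s => p s)]
  exact stdSimplex.sum_eq_one p

/-- Under a product distribution, two different coordinates are independent. -/
theorem sum_prod_mul_apply_mul_apply {ι α : Type} [Fintype ι] [DecidableEq ι] [Fintype α]
    (w : ι → FinDist α) {i j : ι} (hij : i ≠ j) (f g : α → ℝ) :
    ∑ a : ι → α, (∏ k, w k (a k)) * (f (a i) * g (a j)) =
      (∑ u, w i u * f u) * ∑ v, w j v * g v := by
  classical
  let F : ι → α → ℝ := fun k u => (if k = i then f u else 1) * (if k = j then g u else 1)
  have hF (a : ι → α) : f (a i) * g (a j) = ∏ k, F k (a k) := by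
    simp only [F, prod_mul_distrib, prod_ite_eq', mem_univ, if_true]
  have hw (k : ι) : ∑ u, w k u * F k u =
      (if k = i then ∑ u, w i u * f u else 1) * (if k = j then ∑ v, w j v * g v else 1) := by
    by_cases hi : k = i
    · subst hi
      simp [F, hij]
    · by_cases hj : k = j
      · subst hj
        simp [F, hi]
      · simp [F, hi, hj]
  calc ∑ a : ι → α, (∏ k, w k (a k)) * (f (a i) * g (a j))
      = ∑ a : ι → α, ∏ k, w k (a k) * F k (a k) := by
        refine sum_congr rfl fun a _ => ?_
        rw [hF a, ← prod_mul_distrib]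
    _ = ∏ k, ∑ u, w k u * F k u := by
        rw [prod_univ_sum, Fintype.piFinset_univ]
    _ = _ := by
        simp only [hw, prod_mul_distrib, prod_ite_eq', mem_univ, if_true]

/-- Agent `i` with signal `t` sees the signal of agent `j` drawn from `q t`. -/
theorem SymmetricPrior.HasPosterior.sum_eq {n : ℕ} {Q : SymmetricPrior n}
    {q : Signal → FinDist Signal} (hQ : Q.HasPosterior q) {i j : Fin n} (hij : i ≠ j) (t : Signal)
    (φ : Signal → ℝ) :
    ∑ S with S i = t, (Q.dist S / Q.dist.prob (fun S' => S' i = t)) * φ (S j) =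
      ∑ s, q t s * φ s := by
  rw [← sum_fiberwise _ (fun S : Fin n → Signal => S j)]
  refine sum_congr rfl fun s _ => ?_
  have hprob : Q.dist.prob (fun S => S i = t ∧ S j = s) =
      ∑ S with S i = t ∧ S j = s, Q.dist S := rfl
  rw [hQ i j hij s t, hprob, sum_div, sum_mul, filter_filter]
  refine sum_congr rfl fun S hS => ?_
  rw [(mem_filter.mp hS).2.2]

/-- The interim utility depends on the prior through the pairwise posteriors only. -/
theorem interimUtility_peerPrediction {n : ℕ} {Q : SymmetricPrior n}
    {q : Signal → FinDist Signal} (hQ : Q.HasPosterior q) (PS : Signal → FinDist Signal → ℝ)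
    (σ : StrategyProfile n (fun _ => Signal) (fun _ => Signal)) (i : Fin n) (t : Signal) :
    (peerPrediction Q q PS).interimUtility σ i t =
      1 / ((n : ℝ) - 1) * ∑ j ∈ univ.erase i, ∑ u, σ i t u *
        ∑ s, q t s * ∑ v, σ j s v * PS v (q u) := by
  have hinner (S : Fin n → Signal) :
      ∑ a : Fin n → Signal, (∏ j, σ j (S j) (a j)) *
        (1 / ((n : ℝ) - 1) * ∑ j ∈ univ.erase i, PS (a j) (q (a i))) =
      1 / ((n : ℝ) - 1) * ∑ j ∈ univ.erase i, ∑ u, σ i (S i) u *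
        ∑ v, σ j (S j) v * PS v (q u) := by
    have hpair (j : Fin n) (hj : j ∈ univ.erase i) :
        ∑ a : Fin n → Signal, (∏ k, σ k (S k) (a k)) * PS (a j) (q (a i)) =
          ∑ u, σ i (S i) u * ∑ v, σ j (S j) v * PS v (q u) := by
      -- Condition on the report `u` of agent `i`.
      have hsplit (a : Fin n → Signal) : PS (a j) (q (a i)) =
          ∑ u, (if a i = u then 1 else 0) * PS (a j) (q u) := by simp
      simp_rw [hsplit, mul_sum]
      rw [sum_comm]
      refine sum_congr rfl fun u _ => ?_
      rw [sum_prod_mul_apply_mul_apply (fun k => σ k (S k)) (ne_of_mem_erase hj).symm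
        (fun x => if x = u then 1 else 0) (fun v => PS v (q u))]
      simp [mul_sum]
    rw [← sum_congr rfl hpair, sum_comm, mul_sum]
    refine sum_congr rfl fun a _ => ?_
    rw [← mul_sum]
    ring
  simp only [BayesianGame.interimUtility, peerPrediction]
  simp_rw [hinner]
  calc _ = ∑ S with S i = t, ∑ j ∈ univ.erase i, ∑ u, 1 / ((n : ℝ) - 1) * (σ i t u *
          (Q.dist S / Q.dist.prob (fun S' => S' i = t) * ∑ v, σ j (S j) v * PS v (q u))) := by
        refine sum_congr rfl fun S hS => ?_
        rw [(mem_filter.mp hS).2]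
        simp only [mul_sum]
        refine sum_congr rfl fun j _ => sum_congr rfl fun u _ => sum_congr rfl fun v _ => ?_
        ring
    _ = ∑ j ∈ univ.erase i, ∑ u, 1 / ((n : ℝ) - 1) * (σ i t u *
          ∑ s, q t s * ∑ v, σ j s v * PS v (q u)) := by
        rw [sum_comm]
        refine sum_congr rfl fun j hj => ?_
        rw [sum_comm]
        refine sum_congr rfl fun u _ => ?_
        rw [← mul_sum, ← mul_sum,
          hQ.sum_eq (ne_of_mem_erase hj).symm t fun s => ∑ v, σ j s v * PS v (q u)]
    _ = _ := by simp only [mul_sum]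

/-- The change of the expected score of the forecast `q s` per unit of probability moved from the
report `ℓ` to the report `h`. -/
def scoreSlope (PS : Signal → FinDist Signal → ℝ) (q : Signal → FinDist Signal) (s : Signal) : ℝ :=
  PS .h (q s) - PS .l (q s)

/-- What an agent with signal `s` loses in expected score, against a truthful reporter, by the
forecast `q s'` instead of `q s`. -/
def scoreLoss (PS : Signal → FinDist Signal → ℝ) (q : Signal → FinDist Signal) (s s' : Signal) :
    ℝ :=
  expectedScore PS (q s) (q s) - expectedScore PS (q s) (q s')

/-- `n - 1` times the shift of the mean probability of an `h` report among the agents other than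
`i`, relative to truthful reporting, in the eyes of an agent who assigns probability `p` to signal
`h`; here `x j` and `y j` are the probabilities with which `j` misreports `ℓ` and `h`. -/
def reportShift {ι : Type} [DecidableEq ι] (D : Finset ι) (x y : ι → ℝ) (p : ℝ) (i : ι) : ℝ :=
  (1 - p) * ∑ j ∈ D.erase i, x j - p * ∑ j ∈ D.erase i, y j

theorem scoreSlope_sub_mul {PS : Signal → FinDist Signal → ℝ} {q : Signal → FinDist Signal} :
    (scoreSlope PS q .h - scoreSlope PS q .l) * (q .h .h - q .l .h) =
      scoreLoss PS q .l .h + scoreLoss PS q .h .l := by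
  have h1 := (q .l).apply_l_add_apply_h
  have h2 := (q .h).apply_l_add_apply_h
  simp only [scoreSlope, scoreLoss, expectedScore, sum_signal]
  rw [← eq_sub_iff_add_eq] at h1 h2
  rw [h1, h2]
  ring

section Gain

variable {n : ℕ} {Q : SymmetricPrior n} {q : Signal → FinDist Signal}

/-- The utility of agent `i` with signal `ℓ` is the truthful one, plus the effect of the shift of the
other reports on the forecast `q ℓ`, plus, weighted with the probability of misreporting, the further
change from switching to the forecast `q h`. -/
theorem mul_interimUtility_l (hn : 2 ≤ n) (hQ : Q.HasPosterior q)
    (PS : Signal → FinDist Signal → ℝ)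
    (σ : StrategyProfile n (fun _ => Signal) (fun _ => Signal)) (i : Fin n) :
    ((n : ℝ) - 1) * (peerPrediction Q q PS).interimUtility σ i .l =
      (n - 1) * expectedScore PS (q .l) (q .l) +
        (scoreSlope PS q .l * reportShift univ (σ · .l .h) (σ · .h .l) (q .l .h) i +
        σ i .l .h * ((scoreSlope PS q .h - scoreSlope PS q .l) *
          reportShift univ (σ · .l .h) (σ · .h .l) (q .l .h) i -
            (n - 1) * scoreLoss PS q .l .h)) := by
  have hn' : (n : ℝ) - 1 ≠ 0 := by
    have : (2 : ℝ) ≤ n := by exact_mod_cast hn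
    linarith
  have hcard : ((n : ℝ) - 1) = ∑ j ∈ univ.erase i, (1 : ℝ) := by
    rw [sum_const, card_erase_of_mem (mem_univ i), card_univ, Fintype.card_fin, nsmul_eq_mul,
      mul_one, Nat.cast_sub (by omega), Nat.cast_one]
  rw [interimUtility_peerPrediction hQ, ← mul_assoc, mul_one_div_cancel hn', one_mul]
  simp only [reportShift]
  rw [hcard]
  simp only [mul_sub, sub_mul, mul_sum, sum_mul, ← sum_add_distrib,
    ← sum_sub_distrib]
  refine sum_congr rfl fun j _ => ?_
  have h1 := (q .l).apply_l_add_apply_h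
  have h2 := (σ i .l).apply_l_add_apply_h
  have h3 := (σ j .l).apply_l_add_apply_h
  have h4 := (σ j .h).apply_l_add_apply_h
  simp only [scoreSlope, scoreLoss, expectedScore, sum_signal]
  rw [← eq_sub_iff_add_eq] at h1 h2 h3
  rw [← eq_sub_iff_add_eq'] at h4
  rw [h1, h2, h3, h4]
  ring

theorem mul_interimUtility_h (hn : 2 ≤ n) (hQ : Q.HasPosterior q)
    (PS : Signal → FinDist Signal → ℝ)
    (σ : StrategyProfile n (fun _ => Signal) (fun _ => Signal)) (i : Fin n) :
    ((n : ℝ) - 1) * (peerPrediction Q q PS).interimUtility σ i .h =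
      (n - 1) * expectedScore PS (q .h) (q .h) +
        (scoreSlope PS q .h * reportShift univ (σ · .l .h) (σ · .h .l) (q .h .h) i -
        σ i .h .l * ((scoreSlope PS q .h - scoreSlope PS q .l) *
          reportShift univ (σ · .l .h) (σ · .h .l) (q .h .h) i +
            (n - 1) * scoreLoss PS q .h .l)) := by
  have hn' : (n : ℝ) - 1 ≠ 0 := by
    have : (2 : ℝ) ≤ n := by exact_mod_cast hn
    linarith
  have hcard : ((n : ℝ) - 1) = ∑ j ∈ univ.erase i, (1 : ℝ) := by
    rw [sum_const, card_erase_of_mem (mem_univ i), card_univ, Fintype.card_fin, nsmul_eq_mul,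
      mul_one, Nat.cast_sub (by omega), Nat.cast_one]
  rw [interimUtility_peerPrediction hQ, ← mul_assoc, mul_one_div_cancel hn', one_mul]
  simp only [reportShift]
  rw [hcard]
  simp only [mul_add, mul_sub, sub_mul, mul_sum, sum_mul, ← sum_add_distrib,
    ← sum_sub_distrib]
  refine sum_congr rfl fun j _ => ?_
  have h1 := (q .h).apply_l_add_apply_h
  have h2 := (σ i .h).apply_l_add_apply_h
  have h3 := (σ j .l).apply_l_add_apply_h
  have h4 := (σ j .h).apply_l_add_apply_h
  simp only [scoreSlope, scoreLoss, expectedScore, sum_signal]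
  rw [← eq_sub_iff_add_eq] at h1 h3
  rw [← eq_sub_iff_add_eq'] at h2 h4
  rw [h1, h2, h3, h4]
  ring

theorem mul_interimUtility_truthful (hn : 2 ≤ n) (hQ : Q.HasPosterior q)
    (PS : Signal → FinDist Signal → ℝ) (i : Fin n) (t : Signal) :
    ((n : ℝ) - 1) * (peerPrediction Q q PS).interimUtility (truthful n) i t =
      (n - 1) * expectedScore PS (q t) (q t) := by
  cases t
  · rw [mul_interimUtility_l hn hQ]
    simp [reportShift, truthful]
  · rw [mul_interimUtility_h hn hQ]
    simp [reportShift, truthful]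

end Gain

/-! ### The inequalities of a coalition -/

theorem sum_erase_le_card_sub_one {ι : Type} [DecidableEq ι] {D : Finset ι} {z : ι → ℝ} {c : ℝ}
    (hz : ∀ i ∈ D, z i ≤ c) {i : ι} (hi : i ∈ D) :
    ∑ j ∈ D.erase i, z j ≤ ((D.card : ℝ) - 1) * c := by
  refine (sum_le_card_nsmul _ _ c fun j hj => hz j (mem_of_mem_erase hj)).trans_eq ?_
  rw [nsmul_eq_mul, card_erase_of_mem hi, Nat.cast_sub (card_pos.mpr ⟨i, hi⟩), Nat.cast_one]

/-- If the forecast `q h` scores better at the report `h`, no agent of a coalition below the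
threshold misreports: misreports towards `ℓ` cannot prevail among the others, and then the agent who
misreports `ℓ` most often gains too little from the shift of the reports. -/
theorem misreports_eq_zero_of_slope_pos {ι : Type} [DecidableEq ι] {D : Finset ι} {x y : ι → ℝ}
    {a b cl ch δl δh N : ℝ} (ha0 : 0 < a) (hab : a < b) (hb1 : b < 1) (hδl : 0 < δl)
    (hδh : 0 < δh) (hN : 0 < N) (hc : cl < ch) (hch : 0 < ch)
    (hx : ∀ i ∈ D, x i ∈ Set.Icc 0 1) (hy : ∀ i ∈ D, y i ∈ Set.Icc 0 1)
    (hH : ((D.card : ℝ) - 1) * ((1 - a) * ch) < N * δl)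
    (hL : ((D.card : ℝ) - 1) * (b * -cl) < N * δh)
    (hl : ∀ i ∈ D, 0 ≤ cl * reportShift D x y a i +
      x i * ((ch - cl) * reportShift D x y a i - N * δl))
    (hh : ∀ i ∈ D, 0 ≤ ch * reportShift D x y b i -
      y i * ((ch - cl) * reportShift D x y b i + N * δh)) :
    ∀ i ∈ D, x i = 0 ∧ y i = 0 := by
  have hNl : 0 < N * δl := mul_pos hN hδl
  have hNh : 0 < N * δh := mul_pos hN hδh
  have hX0 (i : ι) : 0 ≤ ∑ j ∈ D.erase i, x j :=
    sum_nonneg fun j hj => (hx j (mem_of_mem_erase hj)).1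
  have hY0 (i : ι) : 0 ≤ ∑ j ∈ D.erase i, y j :=
    sum_nonneg fun j hj => (hy j (mem_of_mem_erase hj)).1
  have hshiftb (i : ι) (hi : i ∈ D) : 0 ≤ reportShift D x y b i := by
    by_contra! hneg
    have hge : -(b * ((D.card : ℝ) - 1)) ≤ reportShift D x y b i := by
      have h1 := sum_erase_le_card_sub_one (fun j hj => (hy j hj).2) hi
      have h2 : 0 ≤ (1 - b) * ∑ j ∈ D.erase i, x j := mul_nonneg (by linarith) (hX0 i)
      have h3 := mul_le_mul_of_nonneg_left h1 (ha0.trans hab).le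
      simp only [reportShift]
      linarith
    have hlie : cl * reportShift D x y b i - N * δh < 0 := by
      rcases le_total 0 cl with h | h
      · linarith [mul_nonpos_of_nonneg_of_nonpos h hneg.le]
      · linarith [mul_le_mul_of_nonpos_left hge h]
    have htruth : ch * reportShift D x y b i < 0 := mul_neg_of_pos_of_neg hch hneg
    -- The gain with signal `h` is an average of the gains from the two reports.
    have hsplit : ch * reportShift D x y b i -
        y i * ((ch - cl) * reportShift D x y b i + N * δh) =
        (1 - y i) * (ch * reportShift D x y b i) +
          y i * (cl * reportShift D x y b i - N * δh) := by ring
    have hgain := hsplit ▸ hh i hi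
    obtain ⟨hy0, hy1⟩ := hy i hi
    rcases hy1.lt_or_eq with h | h
    · linarith [mul_neg_of_pos_of_neg (sub_pos.mpr h) htruth,
        mul_nonpos_of_nonneg_of_nonpos hy0 hlie.le]
    · rw [h] at hgain
      linarith
  have hshifta (i : ι) (hi : i ∈ D) : 0 ≤ reportShift D x y a i := by
    have : reportShift D x y a i = reportShift D x y b i +
        (b - a) * (∑ j ∈ D.erase i, x j + ∑ j ∈ D.erase i, y j) := by
      simp only [reportShift]
      ring
    rw [this]
    exact add_nonneg (hshiftb i hi) (mul_nonneg (by linarith) (add_nonneg (hX0 i) (hY0 i)))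
  have hxzero : ∀ i ∈ D, x i = 0 := by
    rcases D.eq_empty_or_nonempty with rfl | hD
    · simp
    obtain ⟨m, hm, hmax⟩ := D.exists_max_image x hD
    suffices h : x m ≤ 0 from fun i hi => le_antisymm ((hmax i hi).trans h) (hx i hi).1
    by_contra! hpos
    have hshift := hshifta m hm
    have hle : reportShift D x y a m ≤ (1 - a) * (((D.card : ℝ) - 1) * x m) := by
      have h1 := mul_le_mul_of_nonneg_left (sum_erase_le_card_sub_one hmax hm)
        (show 0 ≤ 1 - a by linarith)
      have h2 := mul_nonneg ha0.le (hY0 m)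
      simp only [reportShift]
      linarith
    have h1 : x m * (N * δl) ≤ ch * reportShift D x y a m := by
      have h2 : 0 ≤ (1 - x m) * (ch - cl) * reportShift D x y a m :=
        mul_nonneg (mul_nonneg (by linarith [(hx m hm).2]) (by linarith)) hshift
      linarith [hl m hm]
    have h3 := mul_le_mul_of_nonneg_left hle hch.le
    have h4 := mul_lt_mul_of_pos_right hH hpos
    linarith
  intro i hi
  refine ⟨hxzero i hi, ?_⟩
  have hX : ∑ j ∈ D.erase i, x j = 0 := sum_eq_zero fun j hj => hxzero j (mem_of_mem_erase hj)
  have hshift : reportShift D x y b i = 0 := by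
    refine le_antisymm ?_ (hshiftb i hi)
    have := mul_nonneg (ha0.trans hab).le (hY0 i)
    simp only [reportShift, hX]
    linarith
  have hgain := hh i hi
  rw [hshift] at hgain
  exact le_antisymm (by nlinarith) (hy i hi).1

/-- Conditions `hH` and `hL` say that the size of the coalition is within the two thresholds;
conditions `hl` and `hh` say that no member loses, given signal `ℓ` and given signal `h`. -/
theorem misreports_eq_zero {ι : Type} [DecidableEq ι] {D : Finset ι} {x y : ι → ℝ}
    {a b cl ch δl δh N : ℝ} (ha0 : 0 < a) (hab : a < b) (hb1 : b < 1) (hδl : 0 < δl)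
    (hδh : 0 < δh) (hN : 0 < N) (hc : cl < ch)
    (hx : ∀ i ∈ D, x i ∈ Set.Icc 0 1) (hy : ∀ i ∈ D, y i ∈ Set.Icc 0 1)
    (hH : ((D.card : ℝ) - 1) * ((1 - a) * ch) < N * δl)
    (hL : ((D.card : ℝ) - 1) * (b * -cl) < N * δh)
    (hl : ∀ i ∈ D, 0 ≤ cl * reportShift D x y a i +
      x i * ((ch - cl) * reportShift D x y a i - N * δl))
    (hh : ∀ i ∈ D, 0 ≤ ch * reportShift D x y b i -
      y i * ((ch - cl) * reportShift D x y b i + N * δh)) :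
    ∀ i ∈ D, x i = 0 ∧ y i = 0 := by
  rcases lt_or_ge 0 ch with hch | hch
  · exact misreports_eq_zero_of_slope_pos ha0 hab hb1 hδl hδh hN hc hch hx hy hH hL hl hh
  -- Otherwise `cl < 0`: exchange the two signals.
  have hswap (p : ℝ) (i : ι) : reportShift D y x (1 - p) i = -reportShift D x y p i := by
    simp only [reportShift]
    ring
  have key := misreports_eq_zero_of_slope_pos (D := D) (x := y) (y := x) (a := 1 - b) (b := 1 - a)
    (cl := -ch) (ch := -cl) (δl := δh) (δh := δl) (by linarith) (by linarith) (by linarith) hδh hδl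
    hN (by linarith) (by linarith) hy hx (by rwa [sub_sub_cancel]) (by rwa [neg_neg])
    (fun i hi => by
      rw [hswap]
      linarith [hh i hi])
    (fun i hi => by
      rw [hswap]
      linarith [hl i hi])
  exact fun i hi => (key i hi).symm

theorem reportShift_univ {ι : Type} [Fintype ι] [DecidableEq ι] {D : Finset ι} {x y : ι → ℝ}
    (hx : ∀ i ∉ D, x i = 0) (hy : ∀ i ∉ D, y i = 0) (p : ℝ) (i : ι) :
    reportShift univ x y p i = reportShift D x y p i := by
  have hsum (z : ι → ℝ) (hz : ∀ i ∉ D, z i = 0) :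
      ∑ j ∈ univ.erase i, z j = ∑ j ∈ D.erase i, z j := by
    refine (sum_subset (erase_subset_erase i (subset_univ D)) fun j hj hjD => hz j fun h => ?_).symm
    exact hjD (mem_erase.mpr ⟨ne_of_mem_erase hj, h⟩)
  rw [reportShift, reportShift, hsum x hx, hsum y hy]

/-! ### The thresholds -/

theorem scoreLoss_pos {PS : Signal → FinDist Signal → ℝ} (hPS : IsStrictlyProper PS)
    {q : Signal → FinDist Signal} {s s' : Signal} (h : q s ≠ q s') : 0 < scoreLoss PS q s s' :=
  sub_pos.mpr <| lt_of_le_of_ne (hPS (q s) (q s')).1 fun he => h ((hPS (q s) (q s')).2 he.symm)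

section Threshold

variable {q : Signal → FinDist Signal} {PS : Signal → FinDist Signal → ℝ} {n : ℕ}

theorem thresholdH_of_slope_pos (h : 0 < scoreSlope PS q .h) :
    thresholdH q PS n =
      ⌈((n : ℝ) - 1) * scoreLoss PS q .l .h / (q .l .l * scoreSlope PS q .h)⌉₊ := by
  rw [thresholdH, if_pos (sub_pos.mp h)]
  simp only [scoreLoss, scoreSlope, expectedScore, mul_sub, sum_sub_distrib]

theorem thresholdL_of_slope_neg (h : scoreSlope PS q .l < 0) :
    thresholdL q PS n =
      ⌈((n : ℝ) - 1) * scoreLoss PS q .h .l / (q .h .h * -scoreSlope PS q .l)⌉₊ := by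
  rw [thresholdL, if_pos (sub_neg.mp h)]
  simp only [scoreLoss, scoreSlope, expectedScore, mul_sub, sum_sub_distrib, neg_sub]

theorem thresholdH_of_slope_nonpos (h : scoreSlope PS q .h ≤ 0) : thresholdH q PS n = n :=
  if_neg (not_lt.mpr (sub_nonpos.mp h))

theorem thresholdL_of_slope_nonneg (h : 0 ≤ scoreSlope PS q .l) : thresholdL q PS n = n :=
  if_neg (not_lt.mpr (sub_nonneg.mp h))

end Threshold

/-- A coalition of size `d` within the ceiling of `r / c` has `d - 1 < r / c`. -/
theorem sub_one_mul_lt_of_le_ceil {d : ℕ} {r c : ℝ} (hd : 1 ≤ d) (hc : 0 < c)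
    (h : d ≤ ⌈r / c⌉₊) : ((d : ℝ) - 1) * c < r := by
  obtain ⟨e, rfl⟩ := Nat.exists_eq_add_of_le' hd
  have := (lt_div_iff₀ hc).mp (Nat.lt_ceil.mp (Nat.lt_of_succ_le h))
  simpa using this

theorem le_sub_one_mul_of_ceil_lt {k : ℕ} {r c : ℝ} (hc : 0 < c) (h : ⌈r / c⌉₊ < k) :
    r ≤ ((k : ℝ) - 1) * c := by
  rw [← div_le_iff₀ hc, le_sub_iff_add_le]
  have : ((⌈r / c⌉₊ : ℝ) + 1) ≤ k := by exact_mod_cast h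
  linarith [Nat.le_ceil (r / c)]

theorem one_lt_of_ceil_lt {k : ℕ} {r c : ℝ} (hr : 0 < r) (hc : 0 < c) (h : ⌈r / c⌉₊ < k) :
    1 < k :=
  lt_of_le_of_lt (Nat.one_le_ceil_iff.mpr (div_pos hr hc)) h

/-! ### Coalitions with a constant report -/

/-- The profile in which the agents of `D` always report `s` and the others are truthful. -/
def constantReport {n : ℕ} (D : Finset (Fin n)) (s : Signal) :
    StrategyProfile n (fun _ => Signal) (fun _ => Signal) :=
  fun i t => if i ∈ D then stdSimplex.vertex s else truthful n i t

section ConstantReport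

variable {n : ℕ} {Q : SymmetricPrior n} {q : Signal → FinDist Signal}
  {PS : Signal → FinDist Signal → ℝ}

theorem reportShift_constantReport_h (D : Finset (Fin n)) (p : ℝ) {i : Fin n} (hi : i ∈ D) :
    reportShift univ (constantReport D .h · .l .h) (constantReport D .h · .h .l) p i =
      ((D.card : ℝ) - 1) * (1 - p) := by
  rw [reportShift_univ (D := D) (fun j hj => by simp [constantReport, hj, truthful])
    (fun j hj => by simp [constantReport, hj, truthful]), reportShift,
    sum_congr rfl (g := fun _ => (1 : ℝ))
      (fun j hj => by simp [constantReport, mem_of_mem_erase hj]),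
    sum_eq_zero (f := fun j => constantReport D .h j .h .l)
      (fun j hj => by simp [constantReport, mem_of_mem_erase hj]),
    sum_const, card_erase_of_mem hi, nsmul_eq_mul, Nat.cast_sub (card_pos.mpr ⟨i, hi⟩),
    Nat.cast_one]
  ring

theorem reportShift_constantReport_l (D : Finset (Fin n)) (p : ℝ) {i : Fin n} (hi : i ∈ D) :
    reportShift univ (constantReport D .l · .l .h) (constantReport D .l · .h .l) p i =
      -(((D.card : ℝ) - 1) * p) := by
  rw [reportShift_univ (D := D) (fun j hj => by simp [constantReport, hj, truthful])
    (fun j hj => by simp [constantReport, hj, truthful]), reportShift,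
    sum_congr rfl (f := fun j => constantReport D .l j .h .l) (g := fun _ => (1 : ℝ))
      (fun j hj => by simp [constantReport, mem_of_mem_erase hj]),
    sum_eq_zero (f := fun j => constantReport D .l j .l .h)
      (fun j hj => by simp [constantReport, mem_of_mem_erase hj]),
    sum_const, card_erase_of_mem hi, nsmul_eq_mul, Nat.cast_sub (card_pos.mpr ⟨i, hi⟩),
    Nat.cast_one]
  ring

/-- A constant report `s` that leaves no member of a coalition worse off at the other signal and
makes the members better off at the signal `s` refutes the equilibrium. -/
theorem not_isBayesianStrongEquilibrium_of_constantReport (hn : 2 ≤ n)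
    {k : ℕ} (hk : 1 ≤ k) (hkn : k ≤ n) (s : Signal)
    (hle : ∀ D : Finset (Fin n), D.card = k → ∀ i ∈ D, ∀ t,
      ((n : ℝ) - 1) * (peerPrediction Q q PS).interimUtility (truthful n) i t ≤
        ((n : ℝ) - 1) * (peerPrediction Q q PS).interimUtility (constantReport D s) i t)
    (hlt : ∀ D : Finset (Fin n), D.card = k → ∀ i ∈ D,
      ((n : ℝ) - 1) * (peerPrediction Q q PS).interimUtility (truthful n) i s <
        ((n : ℝ) - 1) * (peerPrediction Q q PS).interimUtility (constantReport D s) i s) :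
    ¬ (peerPrediction Q q PS).IsBayesianStrongEquilibrium k (truthful n) := by
  have hn' : 0 < (n : ℝ) - 1 := by
    have : (2 : ℝ) ≤ n := by exact_mod_cast hn
    linarith
  obtain ⟨D, -, hD⟩ := exists_subset_card_eq (s := (univ : Finset (Fin n))) (n := k) (by simpa)
  obtain ⟨i, hi⟩ : D.Nonempty := card_pos.mp (by omega)
  have hgain := lt_of_mul_lt_mul_left (hlt D hD i hi) hn'.le
  refine not_not.mpr ⟨D, constantReport D s, hD.le, ?_, ?_, ?_, i, hi, s, hgain⟩
  · intro h
    rw [h] at hgain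
    exact hgain.false
  · intro j hj
    funext t
    simp [constantReport, hj]
  · exact fun j hj t => le_of_mul_le_mul_left (hle D hD j hj t) hn'

theorem not_isBayesianStrongEquilibrium_of_thresholdH_lt (hn : 2 ≤ n) (hQ : Q.HasPosterior q)
    (hl : 0 < q .l .l) (hh : q .h .h < 1) (hloss : 0 < scoreLoss PS q .l .h) {k : ℕ}
    (hk : thresholdH q PS n < k) (hkn : k ≤ n) :
    ¬ (peerPrediction Q q PS).IsBayesianStrongEquilibrium k (truthful n) := by
  have hslope : 0 < scoreSlope PS q .h := by
    by_contra! h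
    rw [thresholdH_of_slope_nonpos h] at hk
    omega
  rw [thresholdH_of_slope_pos hslope] at hk
  have hn' : 0 < (n : ℝ) - 1 := by
    have : (2 : ℝ) ≤ n := by exact_mod_cast hn
    linarith
  have hk1 := one_lt_of_ceil_lt (mul_pos hn' hloss) (mul_pos hl hslope) hk
  have hk1' : (0 : ℝ) < k - 1 := by
    rw [sub_pos]
    exact_mod_cast hk1
  have hlarge := le_sub_one_mul_of_ceil_lt (mul_pos hl hslope) hk
  have hlt (D : Finset (Fin n)) (hD : D.card = k) (i : Fin n) (hi : i ∈ D) :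
      ((n : ℝ) - 1) * (peerPrediction Q q PS).interimUtility (truthful n) i .h <
        ((n : ℝ) - 1) * (peerPrediction Q q PS).interimUtility (constantReport D .h) i .h := by
    rw [mul_interimUtility_truthful hn hQ, mul_interimUtility_h hn hQ,
      reportShift_constantReport_h D _ hi, hD]
    have hgain := mul_pos hslope (mul_pos hk1' (sub_pos.mpr hh))
    simpa [constantReport, hi] using hgain
  refine not_isBayesianStrongEquilibrium_of_constantReport hn hk1.le hkn .h ?_ hlt
  rintro D hD i hi (_ | _)
  · rw [mul_interimUtility_truthful hn hQ, mul_interimUtility_l hn hQ,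
      reportShift_constantReport_h D _ hi, hD]
    have hreport : constantReport D .h i .l .h = 1 := by simp [constantReport, hi]
    have hsum : 1 - q .l .h = q .l .l := by linarith [(q .l).apply_l_add_apply_h]
    rw [hreport, hsum]
    linarith
  · exact (hlt D hD i hi).le

theorem not_isBayesianStrongEquilibrium_of_thresholdL_lt (hn : 2 ≤ n) (hQ : Q.HasPosterior q)
    (hh : 0 < q .h .h) (hl : 0 < q .l .h) (hloss : 0 < scoreLoss PS q .h .l) {k : ℕ}
    (hk : thresholdL q PS n < k) (hkn : k ≤ n) :
    ¬ (peerPrediction Q q PS).IsBayesianStrongEquilibrium k (truthful n) := by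
  have hslope : scoreSlope PS q .l < 0 := by
    by_contra! h
    rw [thresholdL_of_slope_nonneg h] at hk
    omega
  rw [thresholdL_of_slope_neg hslope] at hk
  have hn' : 0 < (n : ℝ) - 1 := by
    have : (2 : ℝ) ≤ n := by exact_mod_cast hn
    linarith
  have hc := mul_pos hh (neg_pos.mpr hslope)
  have hk1 := one_lt_of_ceil_lt (mul_pos hn' hloss) hc hk
  have hk1' : (0 : ℝ) < k - 1 := by
    rw [sub_pos]
    exact_mod_cast hk1
  have hlarge := le_sub_one_mul_of_ceil_lt hc hk
  have hlt (D : Finset (Fin n)) (hD : D.card = k) (i : Fin n) (hi : i ∈ D) :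
      ((n : ℝ) - 1) * (peerPrediction Q q PS).interimUtility (truthful n) i .l <
        ((n : ℝ) - 1) * (peerPrediction Q q PS).interimUtility (constantReport D .l) i .l := by
    rw [mul_interimUtility_truthful hn hQ, mul_interimUtility_l hn hQ,
      reportShift_constantReport_l D _ hi, hD]
    have hreport : constantReport D .l i .l .h = 0 := by simp [constantReport, hi]
    have hgain := mul_pos (neg_pos.mpr hslope) (mul_pos hk1' hl)
    rw [hreport]
    linarith
  refine not_isBayesianStrongEquilibrium_of_constantReport hn hk1.le hkn .l ?_ hlt
  rintro D hD i hi (_ | _)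
  · exact (hlt D hD i hi).le
  · rw [mul_interimUtility_truthful hn hQ, mul_interimUtility_h hn hQ,
      reportShift_constantReport_l D _ hi, hD]
    have hreport : constantReport D .l i .h .l = 1 := by simp [constantReport, hi]
    rw [hreport]
    linarith

end ConstantReport

/-! ### Truthful reporting below the threshold -/

theorem truthful_of_misreports_eq_zero {σ : Signal → FinDist Signal} (hl : σ .l .h = 0)
    (hh : σ .h .l = 0) (t : Signal) : σ t = stdSimplex.vertex t := by
  have h1 := (σ .l).apply_l_add_apply_h
  have h2 := (σ .h).apply_l_add_apply_h
  refine stdSimplex.ext (funext fun s => ?_)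
  cases t <;> cases s <;> simp <;> linarith

theorem isBayesianStrongEquilibrium_of_le_threshold {n : ℕ} {Q : SymmetricPrior n}
    {q : Signal → FinDist Signal} {PS : Signal → FinDist Signal → ℝ} (hn : 2 ≤ n)
    (hQ : Q.HasPosterior q) (hl : 0 < q .l .h) (hlh : q .l .h < q .h .h) (hh : q .h .h < 1)
    (hlossl : 0 < scoreLoss PS q .l .h) (hlossh : 0 < scoreLoss PS q .h .l) {k : ℕ}
    (hk : k ≤ threshold q PS n) :
    (peerPrediction Q q PS).IsBayesianStrongEquilibrium k (truthful n) := by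
  rintro ⟨D, σ, hDk, hne, hoff, hge, i₀, hi₀, -⟩
  have hn' : 0 < (n : ℝ) - 1 := by
    have : (2 : ℝ) ≤ n := by exact_mod_cast hn
    linarith
  have hD1 : 1 ≤ D.card := card_pos.mpr ⟨i₀, hi₀⟩
  have hD1' : (0 : ℝ) ≤ D.card - 1 := by
    rw [sub_nonneg]
    exact_mod_cast hD1
  have hDH : D.card ≤ thresholdH q PS n := by
    unfold threshold at hk
    omega
  have hDL : D.card ≤ thresholdL q PS n := by
    unfold threshold at hk
    omega
  have hll : 1 - q .l .h = q .l .l := by linarith [(q .l).apply_l_add_apply_h]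
  have hslope : scoreSlope PS q .l < scoreSlope PS q .h := by
    refine sub_pos.mp (pos_of_mul_pos_left ?_ (sub_pos.mpr hlh).le)
    rw [scoreSlope_sub_mul]
    exact add_pos hlossl hlossh
  have hH : ((D.card : ℝ) - 1) * ((1 - q .l .h) * scoreSlope PS q .h) <
      (n - 1) * scoreLoss PS q .l .h := by
    rcases lt_or_ge 0 (scoreSlope PS q .h) with h | h
    · rw [thresholdH_of_slope_pos h] at hDH
      rw [hll]
      exact sub_one_mul_lt_of_le_ceil hD1 (mul_pos (by linarith) h) hDH
    · refine lt_of_le_of_lt ?_ (mul_pos hn' hlossl)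
      exact mul_nonpos_of_nonneg_of_nonpos hD1' (mul_nonpos_of_nonneg_of_nonpos (by linarith) h)
  have hL : ((D.card : ℝ) - 1) * (q .h .h * -scoreSlope PS q .l) <
      (n - 1) * scoreLoss PS q .h .l := by
    rcases lt_or_ge (scoreSlope PS q .l) 0 with h | h
    · rw [thresholdL_of_slope_neg h] at hDL
      exact sub_one_mul_lt_of_le_ceil hD1 (mul_pos (by linarith) (neg_pos.mpr h)) hDL
    · refine lt_of_le_of_lt ?_ (mul_pos hn' hlossh)
      exact mul_nonpos_of_nonneg_of_nonpos hD1'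
        (mul_nonpos_of_nonneg_of_nonpos (by linarith) (by linarith))
  have hxoff : ∀ i ∉ D, σ i .l .h = 0 := fun i hi => by simp [hoff i hi, truthful]
  have hyoff : ∀ i ∉ D, σ i .h .l = 0 := fun i hi => by simp [hoff i hi, truthful]
  have key := misreports_eq_zero (D := D) (x := (σ · .l .h)) (y := (σ · .h .l)) hl hlh hh hlossl
    hlossh hn' hslope (fun i _ => ⟨stdSimplex.zero_le _ _, stdSimplex.le_one _ _⟩)
    (fun i _ => ⟨stdSimplex.zero_le _ _, stdSimplex.le_one _ _⟩) hH hL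
    (fun i hi => by
      have h := mul_le_mul_of_nonneg_left (hge i hi .l) hn'.le
      rw [mul_interimUtility_truthful hn hQ, mul_interimUtility_l hn hQ,
        reportShift_univ hxoff hyoff] at h
      linarith)
    (fun i hi => by
      have h := mul_le_mul_of_nonneg_left (hge i hi .h) hn'.le
      rw [mul_interimUtility_truthful hn hQ, mul_interimUtility_h hn hQ,
        reportShift_univ hxoff hyoff] at h
      linarith)
  refine hne (funext fun i => funext fun t => ?_)
  by_cases hi : i ∈ D
  · exact truthful_of_misreports_eq_zero (key i hi).1 (key i hi).2 t
  · rw [hoff i hi]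

theorem theorem2 (q : Signal → FinDist Signal)
    (hq : q .h .h > q .l .h) (hlh : q .l .h > 0) (hhl : q .h .l > 0)
    (PS : Signal → FinDist Signal → ℝ) (hPS : IsStrictlyProper PS) :
    ∃ n₀ : ℕ, ∀ n : ℕ, n₀ ≤ n → ∀ Q : SymmetricPrior n, Q.HasPosterior q →
      (∀ k : ℕ, 1 ≤ k → k ≤ threshold q PS n →
        (peerPrediction Q q PS).IsBayesianStrongEquilibrium k (truthful n)) ∧
      (∀ k : ℕ, threshold q PS n < k → k ≤ n →
        ¬ (peerPrediction Q q PS).IsBayesianStrongEquilibrium k (truthful n)) := by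
  have hne : q .l ≠ q .h := by
    intro h
    rw [h] at hq
    exact hq.false
  have hlossl : 0 < scoreLoss PS q .l .h := scoreLoss_pos hPS hne
  have hlossh : 0 < scoreLoss PS q .h .l := scoreLoss_pos hPS hne.symm
  have hh1 : q .h .h < 1 := by linarith [(q .h).apply_l_add_apply_h]
  have hll : 0 < q .l .l := by linarith [(q .l).apply_l_add_apply_h]
  -- Two agents are enough for the average over the other agents to make sense.
  refine ⟨2, fun n hn Q hQ => ⟨fun k _ hk => ?_, fun k hk hkn => ?_⟩⟩
  · exact isBayesianStrongEquilibrium_of_le_threshold hn hQ hlh hq hh1 hlossl hlossh hk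
  · rcases lt_or_ge (thresholdH q PS n) k with h | h
    · exact not_isBayesianStrongEquilibrium_of_thresholdH_lt hn hQ hll hh1 hlossl h hkn
    · refine not_isBayesianStrongEquilibrium_of_thresholdL_lt hn hQ (hlh.trans hq) hlh hlossh ?_ hkn
      unfold threshold at hk
      omega
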